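/- **Theorem (fully-dynamic general framework).** Let $\mathcal F$ be a family of objects and $Q$ a set of test elements, with an incidence relation between objects and test elements (for instance: objects in the plane and points, where $s$ and $q$ are incident if $q\in s$; or points in the plane and ranges, where $s$ and $q$ are incident if $s\in q$). For a finite set $S$ of objects and $q\in Q$ let $S_q$ be the set of objects of $S$ incident to $q$. A coloring $\mathrm{col}:S\to\mathbb N$ is *conflict-free* (a CF-coloring) if for every $q$ with $S_q\ne\emptyset$ some object of $S_q$ has a color that no other object of $S_q$ has; it is *unimax* if for every $q$ with $S_q\neq\emptyset$ the maximum color in $S_q$ is attained by exactly one object of $S_q$. A unimax coloring of a set $A$ *admits weak deletions with $m$ colors at the cost of $\rho$ recolorings* if, starting from this coloring, one can maintain a unimax coloring of the remaining objects while the objects of $A$ are deleted one by one in an arbitrary order not known in advance, such that at any time at most $m$ colors are used and each deletion changes the color of at most $\rho$ remaining objects. Let $\gamma_{\mathrm{um}},r:\mathbb N\to\mathbb N$ be non-decreasing. Suppose that, for every $n$, every set of $n$ objects from $\mathcal F$ has a unimax coloring with at most $\gamma_{\mathrm{um}}(n)$ colors that admits weak deletions with $\gamma_{\mathrm{um}}(n)$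 colors at the cost of $r(n)$ recolorings. Then, starting from the empty set, one can maintain a CF-coloring of a finite set $S$ of objects from $\mathcal F$ under an arbitrary sequence, not known in advance, of insertions (of objects of $\mathcal F$ not in $S$) and deletions (of objects in $S$), such that, where $n=|S|$ is the current number of objects (for an update: after the update), * whenever $n\ge 2$, the number of colors used on $S$ is $O\big(\sum_{i=0}^{k}\gamma_{\mathrm{um}}(2^i)\cdot\log n\big)$, where $k=k(n)=\Theta(\log n)$; * each insertion changes the color of $O(\log n)$ objects that were already present; * each deletion changes the color of $O(r(8n)+1)$ remaining objects. The function $k$ and the constants hidden in the $O$- and $\Theta$-notation are absolute: they do not depend on $\mathcal F$, $Q$, $\gamma_{\mathrm{um}}$, $r$ or the sequence of updates. -/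

import Mathlib

namespace DynamicCF

/-- A coloring of the finite set `S` of objects is conflict-free with respect to the test elements
in `Pt` (for objects versus points: `inc s q` says that the point `q` lies in the object `s`; for
points versus ranges: `inc s q` says that the point `s` lies in the range `q`) if, whenever some
object of `S` is incident to `q`, some such object has a color that no other such object has. -/
def IsConflictFree {Obj Pt : Type*} (inc : Obj → Pt → Prop) (S : Finset Obj) (c : Obj → ℕ) :
    Prop :=
  ∀ q : Pt, (∃ s ∈ S, inc s q) →
    ∃ s ∈ S, inc s q ∧ ∀ t ∈ S, inc t q → t ≠ s → c t ≠ c s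

/-- A coloring is unimax if, whenever some object of `S` is incident to `q`, the maximum color among
these objects is attained by exactly one of them. -/
def IsUnimax {Obj Pt : Type*} (inc : Obj → Pt → Prop) (S : Finset Obj) (c : Obj → ℕ) : Prop :=
  ∀ q : Pt, (∃ s ∈ S, inc s q) →
    ∃ s ∈ S, inc s q ∧ ∀ t ∈ S, inc t q → t ≠ s → c t < c s

theorem IsUnimax.isConflictFree {Obj Pt : Type*} {inc : Obj → Pt → Prop} {S : Finset Obj}
    {c : Obj → ℕ} (h : IsUnimax inc S c) : IsConflictFree inc S c := by
  intro q hq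
  obtain ⟨s, hs, hsq, hmax⟩ := h q hq
  exact ⟨s, hs, hsq, fun t ht htq hne => (hmax t ht htq hne).ne⟩

/-- The number of colors that the coloring `c` uses on `S`. -/
def numColors {Obj : Type*} (S : Finset Obj) (c : Obj → ℕ) : ℕ :=
  (S.image c).card

/-- The number of recolorings when the colored set `(S, c)` is turned into `(S', c')`: the number of
objects present before and after whose color differs. -/
def numRecolorings {Obj : Type*} [DecidableEq Obj] (S S' : Finset Obj) (c c' : Obj → ℕ) : ℕ :=
  ((S ∩ S').filter fun x => c x ≠ c' x).card

/-- The coloring `c` of `A` admits weak deletions with at most `m` colors, at the cost of `ρ`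
recolorings per deletion. Here `l` is the list of the objects deleted so far, the most recent one
first, and `col l` is the coloring of the remaining objects after these deletions. -/
def AdmitsWeakDeletions {Obj Pt : Type*} [DecidableEq Obj] (inc : Obj → Pt → Prop)
    (A : Finset Obj) (c : Obj → ℕ) (m ρ : ℕ) : Prop :=
  ∃ col : List Obj → Obj → ℕ, col [] = c ∧
    ∀ l : List Obj, l.Nodup → (∀ x ∈ l, x ∈ A) →
      IsUnimax inc (A \ l.toFinset) (col l) ∧
      numColors (A \ l.toFinset) (col l) ≤ m ∧
      ∀ x ∈ A \ l.toFinset,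
        numRecolorings (A \ l.toFinset) (A \ (x :: l).toFinset) (col l) (col (x :: l)) ≤ ρ

/-- An update of the maintained set. -/
inductive Update (Obj : Type*) where
  | ins (s : Obj) : Update Obj
  | del (s : Obj) : Update Obj

/-- The set that results from the empty set by a sequence of updates, the most recent one first. -/
def objects {Obj : Type*} [DecidableEq Obj] : List (Update Obj) → Finset Obj
  | [] => ∅
  | Update.ins s :: h => insert s (objects h)
  | Update.del s :: h => (objects h).erase s

/-- Sequences of updates (the most recent one first) that start from the empty set, insert only
objects of the family `F` that are not present, and delete only objects that are present. -/
def IsValid {Obj : Type*} [DecidableEq Obj] (F : Set Obj) : List (Update Obj) → Prop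
  | [] => True
  | Update.ins s :: h => IsValid F h ∧ s ∈ F ∧ s ∉ objects h
  | Update.del s :: h => IsValid F h ∧ s ∈ objects h

end DynamicCF

open DynamicCF

/-! Time is measured by insertions: the birth time of an object is the number of insertions before
its own. For every dyadic interval of birth times there is a block, a set built once all its birth
times have passed, with the given unimax coloring maintained under weak deletions. Base structures
contain all objects present at the start of an epoch, an epoch being about half as many updates as
there were objects when it began. All structures have disjoint palettes. Any base outranks any
block, later bases outrank earlier ones, and larger blocks outrank smaller ones.

No structure takes over at once. It activates its objects in order of decreasing color, a bounded
number per update. A top segment of a unimax coloring is unimax (`isUnimax_topSet`), and giving each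
object the color from the highest-ranked structure in which it is active preserves conflict-freeness
(`isConflictFree_layeredColor`). Blocks of size 1 are active immediately, so every object has a
color.

Few structures are visible. The base of the previous epoch is fully active, so older bases, and
blocks born entirely before it, are hidden; this leaves two bases and O(log n) levels. A block is
hidden once its parent is fully active, which leaves at most four blocks per level. This bounds the
colors, even without the additional logarithmic factor.

The waiting times are staggered so that at each level only one block is filling at any time; hence
an insertion recolors O(log n) objects. A deletion affects only the two bases and those visible
blocks that contain the deleted object. Their size is within a constant factor of its age, so at
most three levels matter, and in each structure a deletion changes O(r + 1) objects
(`card_topSet_erase_le`, `card_changed_del`). -/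

namespace DynamicCF

/-! ### Top segments of a ranked finite set -/

section TopSet

variable {Obj κ : Type*} [LinearOrder κ]

/-- The elements of `X` that have fewer than `τ` elements of `X` above them with respect to `k`. -/
def topSet (X : Finset Obj) (k : Obj → κ) (τ : ℕ) : Finset Obj :=
  X.filter fun x => (X.filter fun y => k x < k y).card < τ

theorem topSet_subset (X : Finset Obj) (k : Obj → κ) (τ : ℕ) : topSet X k τ ⊆ X :=
  Finset.filter_subset _ _

theorem topSet_zero (X : Finset Obj) (k : Obj → κ) : topSet X k 0 = ∅ := by
  simp [topSet]

theorem topSet_mono (X : Finset Obj) (k : Obj → κ) {τ τ' : ℕ} (h : τ ≤ τ') :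
    topSet X k τ ⊆ topSet X k τ' := by
  intro x hx
  simp only [topSet, Finset.mem_filter] at hx ⊢
  exact ⟨hx.1, hx.2.trans_le h⟩

theorem topSet_eq_self {X : Finset Obj} (k : Obj → κ) {τ : ℕ} (h : X.card ≤ τ) :
    topSet X k τ = X := by
  refine Finset.filter_true_of_mem fun x hx => lt_of_lt_of_le (Finset.card_lt_card ?_) h
  exact Finset.filter_ssubset.2 ⟨x, hx, lt_irrefl _⟩

theorem mem_topSet_of_le {X : Finset Obj} {k : Obj → κ} {τ : ℕ} {x y : Obj}
    (hy : y ∈ topSet X k τ) (hx : x ∈ X) (hxy : k y ≤ k x) : x ∈ topSet X k τ := by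
  simp only [topSet, Finset.mem_filter] at hy ⊢
  refine ⟨hx, lt_of_le_of_lt (Finset.card_le_card ?_) hy.2⟩
  exact Finset.monotone_filter_right _ fun z _ hz => lt_of_le_of_lt hxy hz

theorem card_topSet {X : Finset Obj} {k : Obj → κ} (hk : Set.InjOn k X) (τ : ℕ) :
    (topSet X k τ).card = min τ X.card := by
  classical
  let rank : Obj → ℕ := fun x => (X.filter fun y => k x < k y).card
  have hlt : ∀ x ∈ X, ∀ y ∈ X, k x < k y → rank y < rank x := by
    intro x _ y hy hxy
    refine Finset.card_lt_card (Finset.ssubset_iff_of_subset ?_ |>.2 ⟨y, ?_, ?_⟩)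
    · exact Finset.monotone_filter_right _ fun z _ hz => lt_trans hxy hz
    · simp [hy, hxy]
    · simp
  have hinj : Set.InjOn rank X := by
    intro x hx y hy hxy
    rcases lt_trichotomy (k x) (k y) with h | h | h
    · exact absurd hxy (hlt x hx y hy h).ne'
    · exact hk hx hy h
    · exact absurd hxy (hlt y hy x hx h).ne
  have himg : X.image rank = Finset.range X.card := by
    refine Finset.eq_of_subset_of_card_le ?_ ?_
    · intro m hm
      obtain ⟨x, hx, rfl⟩ := Finset.mem_image.1 hm
      exact Finset.mem_range.2
        (Finset.card_lt_card (Finset.filter_ssubset.2 ⟨x, hx, lt_irrefl _⟩))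
    · rw [Finset.card_image_of_injOn hinj, Finset.card_range]
  have h2 : (topSet X k τ).image rank = Finset.range (min τ X.card) := by
    ext m
    have := congrArg (m ∈ ·) himg
    simp only [Finset.mem_image, Finset.mem_range, eq_iff_iff] at this
    simp only [Finset.mem_image, Finset.mem_range, topSet, Finset.mem_filter, lt_min_iff, ← this]
    constructor
    · rintro ⟨x, ⟨hx, hr⟩, rfl⟩
      exact ⟨hr, x, hx, rfl⟩
    · rintro ⟨hr, x, hx, rfl⟩
      exact ⟨x, ⟨hx, hr⟩, rfl⟩
  rw [← Finset.card_image_of_injOn (hinj.mono (Finset.coe_subset.2 (topSet_subset X k τ))), h2,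
    Finset.card_range]

/-- If one element is erased and the keys of the elements outside `D` are kept, the sets of the top
`τ` elements differ in at most `2 * D.card + 1` remaining elements. -/
theorem card_topSet_erase_le [DecidableEq Obj] {X : Finset Obj} {s : Obj} (hs : s ∈ X)
    {k k' : Obj → κ} (hk : Set.InjOn k X) (hk' : Set.InjOn k' (X.erase s)) (D : Finset Obj)
    (hD : ∀ x ∈ X.erase s, x ∉ D → k x = k' x) (τ : ℕ) :
    ((topSet X k τ).erase s \ topSet (X.erase s) k' τ).card +
      (topSet (X.erase s) k' τ \ (topSet X k τ).erase s).card ≤ 2 * D.card + 1 := by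
  set M := topSet X k τ with hM
  set M' := topSet (X.erase s) k' τ with hM'
  have hMX : M ⊆ X := topSet_subset _ _ _
  have hMX' : M' ⊆ X.erase s := topSet_subset _ _ _
  have hc : M.card = min τ X.card := card_topSet hk τ
  have hc' : M'.card = min τ (X.erase s).card := card_topSet hk' τ
  have hX : (X.erase s).card + 1 = X.card := Finset.card_erase_add_one hs
  have he1 : M.card - 1 ≤ (M.erase s).card := Finset.pred_card_le_card_erase
  have he2 : (M.erase s).card ≤ M.card := Finset.card_erase_le
  have h1 := Finset.card_sdiff_add_card_inter (M.erase s) M'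
  have h2 := Finset.card_sdiff_add_card_inter M' (M.erase s)
  rw [Finset.inter_comm] at h2
  -- An element leaving and one entering, both with unchanged keys, would have to be ordered in both
  -- ways.
  have key : M.erase s \ M' ⊆ D ∨ M' \ M.erase s ⊆ D := by
    by_contra hcon
    rw [not_or, Finset.not_subset, Finset.not_subset] at hcon
    obtain ⟨⟨y, hy, hyD⟩, x, hx, hxD⟩ := hcon
    rw [Finset.mem_sdiff, Finset.mem_erase] at hy
    rw [Finset.mem_sdiff, Finset.mem_erase] at hx
    have hxX := hMX' hx.1
    have hyX : y ∈ X.erase s := Finset.mem_erase.2 ⟨hy.1.1, hMX hy.1.2⟩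
    have hxM : x ∉ M := fun h => hx.2 ⟨(Finset.mem_erase.1 hxX).1, h⟩
    have e1 : k x < k y := by
      by_contra h
      exact hxM (mem_topSet_of_le hy.1.2 (Finset.mem_of_mem_erase hxX) (not_lt.1 h))
    have e2 : k' y < k' x := by
      by_contra h
      exact hy.2 (mem_topSet_of_le hx.1 hyX (not_lt.1 h))
    rw [hD x hxX hxD, hD y hyX hyD] at e1
    exact lt_asymm e1 e2
  -- The two sets differ in size by at most 1, so the difference not contained in `D` has at most
  -- `D.card + 1` elements.
  rcases key with h | h <;> have := Finset.card_le_card h <;> omega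

/-- If a top segment meets the objects incident to `q`, it contains the one of maximum color, which
is ranked above the others. The component `b` only breaks ties. -/
theorem isUnimax_topSet {Pt : Type*} {inc : Obj → Pt → Prop} {X : Finset Obj} {c : Obj → ℕ}
    (h : IsUnimax inc X c) (b : Obj → ℕ) (τ : ℕ) :
    IsUnimax inc (topSet X (fun x => toLex (c x, b x)) τ) c := by
  rintro q ⟨y, hy, hyq⟩
  obtain ⟨s, hs, hsq, hmax⟩ := h q ⟨y, topSet_subset _ _ _ hy, hyq⟩
  refine ⟨s, ?_, hsq, fun t ht => hmax t (topSet_subset _ _ _ ht)⟩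
  by_cases hys : y = s
  · exact hys ▸ hy
  · refine mem_topSet_of_le hy hs ?_
    rw [Prod.Lex.toLex_le_toLex]
    exact Or.inl (hmax y (topSet_subset _ _ _ hy) hyq hys)

end TopSet

/-! ### Colorings assembled from layers with disjoint palettes -/

section Layered

variable {Obj Pt ι : Type*} [Encodable ι]

/-- The coloring in which `x` has the color `c (key x) x` of the palette of `key x`. -/
def layeredColor (key : Obj → ι) (c : ι → Obj → ℕ) (x : Obj) : ℕ :=
  Nat.pair (Encodable.encode (key x)) (c (key x) x)

theorem layeredColor_eq_iff {key key' : Obj → ι} {c c' : ι → Obj → ℕ} {x y : Obj} :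
    layeredColor key c x = layeredColor key' c' y ↔
      key x = key' y ∧ c (key x) x = c' (key' y) y := by
  simp [layeredColor, Nat.pair_eq_pair]

/-- Among the objects incident to `q`, take the highest key that occurs. Every incident object in
that layer has this very key, so the object singled out by the layer's coloring really shows its
color; other layers use other palettes. -/
theorem isConflictFree_layeredColor {P : Type*} [LinearOrder P] {ord : ι → P}
    (hord : Function.Injective ord) {inc : Obj → Pt → Prop} {S : Finset Obj} {key : Obj → ι}
    {M : ι → Finset Obj} {c : ι → Obj → ℕ} (hM : ∀ i, M i ⊆ S) (hkey : ∀ x ∈ S, x ∈ M (key x))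
    (hmax : ∀ x ∈ S, ∀ i, x ∈ M i → ord i ≤ ord (key x))
    (hc : ∀ i, IsConflictFree inc (M i) (c i)) :
    IsConflictFree inc S (layeredColor key c) := by
  classical
  rintro q ⟨y, hy, hyq⟩
  obtain ⟨x, hx, hxmax⟩ := Finset.exists_max_image (S.filter fun x => inc x q)
    (fun x => ord (key x)) ⟨y, by simp [hy, hyq]⟩
  simp only [Finset.mem_filter] at hx hxmax
  obtain ⟨s, hs, hsq, huniq⟩ := hc (key x) q ⟨x, hkey x hx.1, hx.2⟩
  have hks : key s = key x := hord
    (le_antisymm (hxmax s ⟨hM _ hs, hsq⟩) (hmax s (hM _ hs) _ hs))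
  refine ⟨s, hM _ hs, hsq, fun t ht htq hts heq => ?_⟩
  obtain ⟨h1, h2⟩ := layeredColor_eq_iff.1 heq
  rw [h1, hks] at h2
  exact huniq t (by rw [← hks, ← h1]; exact hkey t ht) htq hts h2

theorem numColors_layeredColor_le {α : Type*} {S : Finset Obj} {key : Obj → ι}
    {M : ι → Finset Obj} {c : ι → Obj → ℕ} (hkey : ∀ x ∈ S, x ∈ M (key x)) {V : Finset α}
    {φ : α → ι} (hV : ∀ x ∈ S, ∃ a ∈ V, φ a = key x) :
    numColors S (layeredColor key c) ≤ ∑ a ∈ V, numColors (M (φ a)) (c (φ a)) := by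
  classical
  have hsub : S.image (layeredColor key c) ⊆
      V.biUnion fun a => ((M (φ a)).image (c (φ a))).image
        (Nat.pair (Encodable.encode (φ a))) := by
    intro m hm
    obtain ⟨x, hx, rfl⟩ := Finset.mem_image.1 hm
    obtain ⟨a, ha, hax⟩ := hV x hx
    refine Finset.mem_biUnion.2 ⟨a, ha, ?_⟩
    rw [hax]
    exact Finset.mem_image_of_mem _ (Finset.mem_image_of_mem _ (hkey x hx))
  calc numColors S (layeredColor key c) ≤ _ := Finset.card_le_card hsub
    _ ≤ _ := Finset.card_biUnion_le
    _ ≤ _ := Finset.sum_le_sum fun i _ => Finset.card_image_le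

/-- A change of the final color is visible in the old or the new key layer: if `x` belongs to both
key layers before and after, maximality makes the keys equal and the color inside that layer has
changed. Hence changes in layers that are never keys cost nothing. -/
theorem numRecolorings_layeredColor_le [DecidableEq Obj] {P : Type*} [LinearOrder P] {ord : ι → P}
    (hord : Function.Injective ord) {S S' : Finset Obj} {key key' : Obj → ι}
    {M M' : ι → Finset Obj} {c c' : ι → Obj → ℕ}
    (hkey : ∀ x ∈ S, x ∈ M (key x)) (hmax : ∀ x ∈ S, ∀ i, x ∈ M i → ord i ≤ ord (key x))
    (hkey' : ∀ x ∈ S', x ∈ M' (key' x)) (hmax' : ∀ x ∈ S', ∀ i, x ∈ M' i → ord i ≤ ord (key' x))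
    {Ch : ι → Finset Obj}
    (hCh : ∀ x ∈ S ∩ S', ∀ i, ¬ (x ∈ M i ↔ x ∈ M' i) ∨ (x ∈ M i ∧ c i x ≠ c' i x) → x ∈ Ch i)
    {W : Finset ι} (hW : ∀ x ∈ S ∩ S', ∀ i, key x = i ∨ key' x = i → x ∈ Ch i → i ∈ W) {B : ℕ}
    (hB : ∀ i ∈ W, (Ch i).card ≤ B) :
    numRecolorings S S' (layeredColor key c) (layeredColor key' c') ≤ W.card * B := by
  classical
  have hsub : ((S ∩ S').filter fun x => layeredColor key c x ≠ layeredColor key' c' x) ⊆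
      W.biUnion Ch := by
    intro x hx
    rw [Finset.mem_filter] at hx
    obtain ⟨hx, hne⟩ := hx
    obtain ⟨hxS, hxS'⟩ := Finset.mem_inter.1 hx
    suffices h : ∃ i, (key x = i ∨ key' x = i) ∧ x ∈ Ch i by
      obtain ⟨i, h1, h2⟩ := h
      exact Finset.mem_biUnion.2 ⟨i, hW x hx i h1 h2, h2⟩
    by_cases h1 : x ∈ M' (key x)
    · by_cases h2 : x ∈ M (key' x)
      · have hkk : key x = key' x :=
          hord (le_antisymm (hmax' x hxS' _ h1) (hmax x hxS _ h2))
        refine ⟨key x, Or.inl rfl, hCh x hx _ (Or.inr ⟨hkey x hxS, fun h => hne ?_⟩)⟩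
        exact layeredColor_eq_iff.2 ⟨hkk, by rw [h, hkk]⟩
      · exact ⟨key' x, Or.inr rfl, hCh x hx _ (Or.inl fun h => h2 (h.2 (hkey' x hxS')))⟩
    · exact ⟨key x, Or.inl rfl, hCh x hx _ (Or.inl fun h => h1 (h.1 (hkey x hxS)))⟩
  calc numRecolorings S S' (layeredColor key c) (layeredColor key' c') ≤ _ :=
        Finset.card_le_card hsub
    _ ≤ _ := Finset.card_biUnion_le_card_mul _ _ _ hB

end Layered

end DynamicCF

namespace DynamicCF

/-! ### Update histories, birth times and surviving objects -/

section History

variable {Obj : Type*}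

/-- The number of insertions in a sequence of updates. -/
def insertions : List (Update Obj) → ℕ
  | [] => 0
  | Update.ins _ :: h => insertions h + 1
  | Update.del _ :: h => insertions h

theorem insertions_le_cons (u : Update Obj) (h : List (Update Obj)) :
    insertions h ≤ insertions (u :: h) ∧ insertions (u :: h) ≤ insertions h + 1 := by
  cases u <;> simp [insertions]

theorem insertions_of_suffix {g h : List (Update Obj)} (hg : g <:+ h) :
    insertions g ≤ insertions h ∧ insertions h + g.length ≤ insertions g + h.length := by
  induction h with
  | nil => simp [List.suffix_nil.1 hg]
  | cons u h ih =>
    rcases List.suffix_cons_iff.1 hg with rfl | hg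
    · simp
    · have := ih hg
      have := insertions_le_cons u h
      simp only [List.length_cons]
      omega

/-- The sequence of the updates up to the `b`-th insertion. -/
def cut (b : ℕ) : List (Update Obj) → List (Update Obj)
  | [] => []
  | u :: h => if b ≤ insertions h then cut b h else u :: h

theorem cut_cons_of_le {b : ℕ} {h : List (Update Obj)} (hb : b ≤ insertions h)
    (u : Update Obj) : cut b (u :: h) = cut b h := if_pos hb

theorem cut_suffix (b : ℕ) (h : List (Update Obj)) : cut b h <:+ h := by
  induction h with
  | nil => exact List.suffix_rfl
  | cons u h ih =>
    rw [cut]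
    split_ifs
    · exact ih.trans (List.suffix_cons u h)
    · exact List.suffix_rfl

theorem insertions_cut {b : ℕ} {h : List (Update Obj)} (hb : b ≤ insertions h) :
    insertions (cut b h) = b := by
  induction h with
  | nil => simpa [cut, insertions] using hb.antisymm' (Nat.zero_le _)
  | cons u h ih =>
    rw [cut]
    split_ifs with h1
    · exact ih h1
    · have := insertions_le_cons u h
      omega

variable [DecidableEq Obj]

/-- The number of insertions before the last insertion of `x`. -/
def birth : List (Update Obj) → Obj → ℕ
  | [], _ => 0
  | Update.ins s :: h, x => if x = s then insertions h else birth h x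
  | Update.del _ :: h, x => birth h x

theorem IsValid.tail {F : Set Obj} {u : Update Obj} {h : List (Update Obj)}
    (hv : IsValid F (u :: h)) : IsValid F h := by
  cases u <;> exact hv.1

theorem IsValid.of_suffix {F : Set Obj} {g h : List (Update Obj)} (hv : IsValid F h)
    (hg : g <:+ h) : IsValid F g := by
  induction h with
  | nil => rwa [List.suffix_nil.1 hg]
  | cons u h ih =>
    rcases List.suffix_cons_iff.1 hg with rfl | hg
    · exact hv
    · exact ih hv.tail hg

theorem IsValid.objects_subset {F : Set Obj} {h : List (Update Obj)} (hv : IsValid F h) :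
    (objects h : Set Obj) ⊆ F := by
  induction h with
  | nil => simp [objects]
  | cons u h ih =>
    cases u with
    | ins s => simpa [objects, Set.insert_subset_iff] using ⟨hv.2.1, ih hv.1⟩
    | del s => exact (Finset.coe_subset.2 (Finset.erase_subset _ _)).trans (ih hv.1)

theorem card_objects_cons {F : Set Obj} {u : Update Obj} {h : List (Update Obj)}
    (hv : IsValid F (u :: h)) :
    (objects h).card ≤ (objects (u :: h)).card + 1 ∧
      (objects (u :: h)).card ≤ (objects h).card + 1 := by
  cases u with
  | ins s => simp [objects, Finset.card_insert_of_notMem hv.2.2]; omega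
  | del s => have := Finset.card_erase_add_one hv.2; simp only [objects]; omega

theorem card_objects_of_suffix {F : Set Obj} {g h : List (Update Obj)} (hv : IsValid F h)
    (hg : g <:+ h) : (objects g).card + g.length ≤ (objects h).card + h.length := by
  induction h with
  | nil => simp [List.suffix_nil.1 hg]
  | cons u h ih =>
    rcases List.suffix_cons_iff.1 hg with rfl | hg
    · rfl
    · have := ih hv.tail hg
      have := card_objects_cons hv
      simp only [List.length_cons]
      omega

theorem birth_lt {F : Set Obj} {h : List (Update Obj)} (hv : IsValid F h) {x : Obj}
    (hx : x ∈ objects h) : birth h x < insertions h := by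
  induction h with
  | nil => simp [objects] at hx
  | cons u h ih =>
    cases u with
    | ins s =>
      simp only [birth, insertions]
      split_ifs with hxs
      · omega
      · have := ih hv.1 (Finset.mem_of_mem_insert_of_ne hx hxs)
        omega
    | del s => exact ih hv.1 (Finset.mem_of_mem_erase hx)

theorem birth_injOn {F : Set Obj} {h : List (Update Obj)} (hv : IsValid F h) :
    Set.InjOn (birth h) (objects h) := by
  induction h with
  | nil => simp [objects]
  | cons u h ih =>
    cases u with
    | ins s =>
      intro x hx y hy hxy
      simp only [birth] at hxy
      by_cases hxs : x = s <;> by_cases hys : y = s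
      · rw [hxs, hys]
      · rw [if_pos hxs, if_neg hys] at hxy
        exact absurd hxy (birth_lt hv.1 (Finset.mem_of_mem_insert_of_ne hy hys)).ne'
      · rw [if_neg hxs, if_pos hys] at hxy
        exact absurd hxy (birth_lt hv.1 (Finset.mem_of_mem_insert_of_ne hx hxs)).ne
      · rw [if_neg hxs, if_neg hys] at hxy
        exact ih hv.1 (Finset.mem_of_mem_insert_of_ne hx hxs)
          (Finset.mem_of_mem_insert_of_ne hy hys) hxy
    | del s => exact (ih hv.1).mono (Finset.coe_subset.2 (Finset.erase_subset _ _))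

theorem birth_del (s x : Obj) (h : List (Update Obj)) :
    birth (Update.del s :: h) x = birth h x := rfl

/-- The objects present after `g` that were born at time `a` or later. -/
def members (g : List (Update Obj)) (a : ℕ) : Finset Obj :=
  (objects g).filter fun x => a ≤ birth g x

theorem members_zero (g : List (Update Obj)) : members g 0 = objects g := by
  simp [members]

theorem card_members_le {F : Set Obj} {g : List (Update Obj)} (hv : IsValid F g) (a : ℕ) :
    (members g a).card ≤ insertions g - a := by
  rw [← Nat.card_Ico]
  refine Finset.card_le_card_of_injOn (birth g) ?_
    ((birth_injOn hv).mono (Finset.coe_subset.2 (Finset.filter_subset _ _)))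
  intro x hx
  have hx' := Finset.mem_filter.1 hx
  simpa using ⟨hx'.2, birth_lt hv hx'.1⟩

/-- The elements of `A` that have been deleted since the sequence of updates had length `T`, each
one listed once. -/
def deleted (A : Finset Obj) (T : ℕ) : List (Update Obj) → List Obj
  | [] => []
  | Update.ins _ :: h => deleted A T h
  | Update.del s :: h =>
    if T ≤ h.length ∧ s ∈ A ∧ s ∉ deleted A T h then s :: deleted A T h else deleted A T h

theorem deleted_nodup (A : Finset Obj) (T : ℕ) (h : List (Update Obj)) :
    (deleted A T h).Nodup := by
  induction h with
  | nil => exact List.nodup_nil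
  | cons u h ih =>
    cases u with
    | ins s => exact ih
    | del s =>
      simp only [deleted]
      split_ifs with hs
      · exact List.nodup_cons.2 ⟨hs.2.2, ih⟩
      · exact ih

theorem mem_of_mem_deleted {A : Finset Obj} {T : ℕ} {h : List (Update Obj)} :
    ∀ x ∈ deleted A T h, x ∈ A := by
  induction h with
  | nil => simp [deleted]
  | cons u h ih =>
    cases u with
    | ins s => exact ih
    | del s =>
      simp only [deleted]
      split_ifs with hs
      · simpa using ⟨hs.2.1, ih⟩
      · exact ih

theorem deleted_eq_nil (A : Finset Obj) {T : ℕ} {h : List (Update Obj)} (hT : h.length ≤ T) :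
    deleted A T h = [] := by
  induction h with
  | nil => rfl
  | cons u h ih =>
    rw [List.length_cons] at hT
    cases u with
    | ins s => exact ih (by omega)
    | del s =>
      simp only [deleted]
      rw [if_neg (by omega), ih (by omega)]

/-- The members of `members g a` that have been present ever since. -/
def survivors (g : List (Update Obj)) (a : ℕ) (h : List (Update Obj)) : Finset Obj :=
  members g a \ (deleted (members g a) g.length h).toFinset

theorem survivors_self (g : List (Update Obj)) (a : ℕ) : survivors g a g = members g a := by
  simp [survivors, deleted_eq_nil]

theorem survivors_ins (g : List (Update Obj)) (a : ℕ) (s : Obj) (h : List (Update Obj)) :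
    survivors g a (Update.ins s :: h) = survivors g a h := rfl

theorem survivors_subset_members (g : List (Update Obj)) (a : ℕ) (h : List (Update Obj)) :
    survivors g a h ⊆ members g a := Finset.sdiff_subset

theorem deleted_del_of_mem {g h : List (Update Obj)} {a : ℕ} {s : Obj} (hg : g <:+ h)
    (hs : s ∈ survivors g a h) :
    deleted (members g a) g.length (Update.del s :: h) =
      s :: deleted (members g a) g.length h := by
  simp only [survivors, Finset.mem_sdiff, List.mem_toFinset] at hs
  simp only [deleted]
  rw [if_pos ⟨hg.length_le, hs⟩]

theorem deleted_del_of_notMem {g h : List (Update Obj)} {a : ℕ} {s : Obj}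
    (hs : s ∉ survivors g a h) :
    deleted (members g a) g.length (Update.del s :: h) = deleted (members g a) g.length h := by
  simp only [survivors, Finset.mem_sdiff, List.mem_toFinset] at hs
  simp only [deleted]
  rw [if_neg (fun h => hs h.2)]

theorem survivors_del {g h : List (Update Obj)} {a : ℕ} {s : Obj} (hg : g <:+ h) :
    survivors g a (Update.del s :: h) = (survivors g a h).erase s := by
  by_cases hs : s ∈ survivors g a h
  · rw [survivors, deleted_del_of_mem hg hs, survivors]
    ext x
    simp only [Finset.mem_sdiff, List.mem_toFinset, List.mem_cons, Finset.mem_erase]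
    tauto
  · rw [survivors, deleted_del_of_notMem hs, Finset.erase_eq_of_notMem hs, survivors]

/-- A reinserted object gets a birth time of at least `insertions g`, so birth times alone tell
survivors from objects that left and came back. -/
theorem mem_survivors {F : Set Obj} {g h : List (Update Obj)} {a : ℕ} {x : Obj}
    (hv : IsValid F h) (hg : g <:+ h) :
    x ∈ survivors g a h ↔ x ∈ objects h ∧ a ≤ birth h x ∧ birth h x < insertions g := by
  induction h with
  | nil => simp [List.suffix_nil.1 hg, survivors, members, objects]
  | cons u h ih =>
    rcases List.suffix_cons_iff.1 hg with rfl | hg'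
    · rw [survivors_self, members, Finset.mem_filter]
      exact ⟨fun h => ⟨h.1, h.2, birth_lt hv h.1⟩, fun h => ⟨h.1, h.2.1⟩⟩
    · have ih := ih hv.tail hg'
      cases u with
      | ins s =>
        rw [survivors_ins, ih]
        by_cases hxs : x = s
        · have := (insertions_of_suffix hg').1
          simp only [hxs, hv.2.2, birth, if_true, objects, Finset.mem_insert_self]
          constructor
          · simp
          · rintro ⟨-, -, h3⟩
            exact absurd h3 (not_lt.2 this)
        · simp [objects, birth, hxs]
      | del s =>
        rw [survivors_del hg', Finset.mem_erase, ih, objects, Finset.mem_erase, birth_del, and_assoc]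

/-! ### Epochs -/

/-- The number of updates in an epoch that starts with `n` objects. -/
def epochLength (n : ℕ) : ℕ := max 1 (n / 2)

/-- The sequence of the updates before the current epoch. -/
def epochStart : List (Update Obj) → List (Update Obj)
  | [] => []
  | u :: h =>
    if (epochStart h).length + epochLength (objects (epochStart h)).card ≤ (u :: h).length then
      u :: h
    else epochStart h

/-- The sequence of the updates before the previous epoch. -/
def prevEpochStart (h : List (Update Obj)) : List (Update Obj) :=
  epochStart (epochStart h).tail

theorem epochStart_suffix (h : List (Update Obj)) : epochStart h <:+ h := by
  induction h with
  | nil => exact List.suffix_rfl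
  | cons u h ih =>
    rw [epochStart]
    split_ifs
    · exact List.suffix_rfl
    · exact ih.trans (List.suffix_cons u h)

theorem epochStart_epochStart (h : List (Update Obj)) :
    epochStart (epochStart h) = epochStart h := by
  induction h with
  | nil => rfl
  | cons u h ih =>
    by_cases hc : (epochStart h).length + epochLength (objects (epochStart h)).card ≤
        (u :: h).length
    · have : epochStart (u :: h) = u :: h := by rw [epochStart, if_pos hc]
      rw [this, this]
    · have : epochStart (u :: h) = epochStart h := by rw [epochStart, if_neg hc]
      rw [this, ih]

theorem length_lt_epochStart (h : List (Update Obj)) :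
    h.length < (epochStart h).length + epochLength (objects (epochStart h)).card := by
  induction h with
  | nil => simp [epochStart, epochLength]
  | cons u h ih =>
    by_cases hc : (epochStart h).length + epochLength (objects (epochStart h)).card ≤
        (u :: h).length
    · rw [epochStart, if_pos hc]
      simp [epochLength]
    · rw [epochStart, if_neg hc]
      omega

/-- Epoch starts are exactly the fixed points of `epochStart`, and `epochStart h` is the latest of
them. -/
theorem length_le_epochStart {g h : List (Update Obj)} (hg : g <:+ h) (he : epochStart g = g) :
    g.length ≤ (epochStart h).length := by
  induction h with
  | nil => simp [List.suffix_nil.1 hg]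
  | cons u h ih =>
    rcases List.suffix_cons_iff.1 hg with rfl | hg
    · rw [he]
    · rw [epochStart]
      split_ifs
      · simpa using hg.length_le.trans (Nat.le_succ _)
      · exact ih hg

theorem prevEpochStart_suffix (h : List (Update Obj)) : prevEpochStart h <:+ epochStart h :=
  (epochStart_suffix _).trans (List.tail_suffix _)

theorem length_epochStart_le (h : List (Update Obj)) :
    (epochStart h).length ≤
      (prevEpochStart h).length + epochLength (objects (prevEpochStart h)).card := by
  have := length_lt_epochStart (epochStart h).tail
  rw [List.length_tail] at this
  simp only [prevEpochStart]
  omega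

/-- A complete epoch starting with `m` objects has at least `max 1 (m / 2)` updates, which is at
least `m / 3`. So activating three objects per update fills a base within its own epoch. -/
theorem card_objects_prevEpochStart_le (h : List (Update Obj)) :
    (objects (prevEpochStart h)).card ≤
      3 * ((epochStart h).length - (prevEpochStart h).length) := by
  have h1 := epochStart_epochStart h
  rw [prevEpochStart]
  cases he : epochStart h with
  | nil => simp [epochStart, objects]
  | cons u g =>
    rw [he, epochStart] at h1
    split_ifs at h1 with hc
    · simp only [List.tail_cons]
      simp only [epochLength] at hc
      omega
    · have := congrArg List.length h1
      have := (epochStart_suffix g).length_le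
      simp only [List.length_cons] at *
      omega

theorem eq_of_epochStart_eq {g h : List (Update Obj)} (hg : g <:+ h) (he : epochStart g = g)
    (hp : (prevEpochStart h).length ≤ g.length) : g = prevEpochStart h ∨ g = epochStart h := by
  have h1 := length_le_epochStart hg he
  have hge : g <:+ epochStart h := List.suffix_of_suffix_length_le hg (epochStart_suffix h) h1
  rcases h1.eq_or_lt with h1 | h1
  · exact Or.inr (hge.eq_of_length h1)
  · left
    have hgt : g <:+ (epochStart h).tail := by
      cases h2 : epochStart h with
      | nil => simp [h2] at h1
      | cons u t =>
        rw [h2] at hge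
        rcases List.suffix_cons_iff.1 hge with rfl | h3
        · rw [h2] at h1; exact absurd h1 (lt_irrefl _)
        · exact h3
    have h4 := length_le_epochStart hgt he
    have h5 : g <:+ prevEpochStart h := List.suffix_of_suffix_length_le hgt (epochStart_suffix _) h4
    exact h5.eq_of_length (le_antisymm h4 hp)

/-- Sizes at the starts of the last two epochs, compared to the size during the current epoch or
immediately after it. -/
theorem epoch_bounds {F : Set Obj} {h H : List (Update Obj)} (hv : IsValid F H)
    (hH : epochStart h <:+ H)
    (hl : H.length ≤ (epochStart h).length + epochLength (objects (epochStart h)).card)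
    (hn : 1 ≤ (objects H).card) :
    (objects (prevEpochStart h)).card ≤ 4 * (objects H).card ∧
      (objects (epochStart h)).card ≤ 4 * (objects H).card ∧
      H.length ≤ (prevEpochStart h).length + 3 * (objects H).card := by
  have h1 := card_objects_of_suffix hv hH
  have h2 := card_objects_of_suffix (hv.of_suffix hH) (prevEpochStart_suffix h)
  have h3 := length_epochStart_le h
  simp only [epochLength] at hl h3
  -- If an epoch starts with `m` objects, then `m ≤ n + max 1 (m / 2)` for the size `n` at its end
  -- or earlier, so sizes at most double per epoch going back when `n ≥ 1`. The epoch lengths are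
  -- then at most `n` and `2 * n`.
  omega

end History

end DynamicCF

namespace DynamicCF

/-! ### Blocks, base structures and their gradual activation -/

/-- The names of the maintained structures: `inl (i, j)` is the structure for the objects with birth
times in `[j * 2 ^ i, (j + 1) * 2 ^ i)`, and `inr T` is the structure for all objects that are
present after `T` updates. -/
abbrev Key := (ℕ × ℕ) ⊕ ℕ

/-- The priority of a structure. -/
def keyOrd : Key → (ℕ ×ₗ ℕ) ⊕ₗ ℕ
  | Sum.inl p => Sum.inlₗ (toLex p)
  | Sum.inr T => Sum.inrₗ T

theorem keyOrd_injective : Function.Injective keyOrd := by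
  rintro (p | T) (p' | T') h <;> simp_all [keyOrd]

theorem not_keyOrd_inr_le_inl (T : ℕ) (p : ℕ × ℕ) :
    ¬ keyOrd (Sum.inr T) ≤ keyOrd (Sum.inl p) :=
  Sum.Lex.not_inr_le_inl

theorem keyOrd_inr_le_inr {T T' : ℕ} : keyOrd (Sum.inr T) ≤ keyOrd (Sum.inr T') ↔ T ≤ T' :=
  Sum.Lex.inr_le_inr_iff

theorem not_keyOrd_succ_le (i j j' : ℕ) :
    ¬ keyOrd (Sum.inl (i + 1, j')) ≤ keyOrd (Sum.inl (i, j)) := by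
  intro h
  have := Sum.Lex.inl_le_inl_iff.1 h
  rw [Prod.Lex.toLex_le_toLex] at this
  simp at this

section Structures

variable {Obj : Type*}

/-- The updates before the structure is created. -/
def source : Key → List (Update Obj) → List (Update Obj)
  | Sum.inl (i, j), h => cut ((j + 1) * 2 ^ i) h
  | Sum.inr T, h => h.drop (h.length - T)

/-- The earliest birth time of the objects in the structure. -/
def low : Key → ℕ
  | Sum.inl (i, j) => j * 2 ^ i
  | Sum.inr _ => 0

/-- The structure has been created. -/
def Ready : Key → List (Update Obj) → Prop
  | Sum.inl (i, j), h => (j + 1) * 2 ^ i ≤ insertions h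
  | Sum.inr T, h => T ≤ h.length

theorem source_suffix (ι : Key) (h : List (Update Obj)) : source ι h <:+ h := by
  rcases ι with ⟨i, j⟩ | T
  · exact cut_suffix _ _
  · exact List.drop_suffix _ _

theorem source_cons {ι : Key} {h : List (Update Obj)} (hr : Ready ι h) (u : Update Obj) :
    source ι (u :: h) = source ι h := by
  rcases ι with ⟨i, j⟩ | T
  · exact cut_cons_of_le hr u
  · simp only [Ready] at hr
    simp only [source, List.length_cons, Nat.succ_sub hr, List.drop_succ_cons]

theorem source_length_suffix {p h : List (Update Obj)} (hp : p <:+ h) :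
    source (Sum.inr p.length) h = p :=
  (List.suffix_iff_eq_drop.1 hp).symm

theorem insertions_source {i j : ℕ} {h : List (Update Obj)} (hr : Ready (Sum.inl (i, j)) h) :
    insertions (source (Sum.inl (i, j)) h) = (j + 1) * 2 ^ i :=
  insertions_cut hr

variable [DecidableEq Obj]

/-- The number of objects that get their color from this structure or from one of a higher
priority. -/
def quota : Key → List (Update Obj) → ℕ
  -- A block waits for about one block length after its creation and then gains one object per
  -- insertion during the next. The offset 2 makes a block of level 0 active as soon as it is
  -- created.
  | Sum.inl (i, j), h => insertions h + 2 - (j + 2) * 2 ^ i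
  | Sum.inr T, h =>
    -- The test says that `T` is the start of an epoch; other bases stay empty.
    if (epochStart (h.drop (h.length - T))).length = (h.drop (h.length - T)).length then
      3 * (h.length - T)
    else 0

theorem quota_eq_zero {ι : Key} {h : List (Update Obj)} (hr : ¬ Ready ι h) : quota ι h = 0 := by
  rcases ι with ⟨i, j⟩ | T
  · have := Nat.one_le_two_pow (n := i)
    simp only [Ready, quota, Nat.add_mul] at *
    omega
  · simp only [Ready, quota, not_le] at *
    rw [Nat.sub_eq_zero_of_le hr.le]
    simp

theorem quota_inl_del (p : ℕ × ℕ) (s : Obj) (h : List (Update Obj)) :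
    quota (Sum.inl p) (Update.del s :: h) = quota (Sum.inl p) h := rfl

theorem quota_cons_le (ι : Key) (u : Update Obj) (h : List (Update Obj)) :
    quota ι h ≤ quota ι (u :: h) ∧ quota ι (u :: h) ≤ quota ι h + 3 := by
  by_cases hr : Ready ι h
  · have hs := source_cons hr u
    rcases ι with ⟨i, j⟩ | T
    · have := insertions_le_cons u h
      simp only [quota]
      omega
    · simp only [source] at hs
      simp only [quota, hs]
      simp only [Ready] at hr
      split_ifs
      · simp only [List.length_cons]; omega
      · omega
  · rw [quota_eq_zero hr]
    refine ⟨Nat.zero_le _, ?_⟩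
    rcases ι with ⟨i, j⟩ | T
    · have := insertions_le_cons u h
      have := Nat.one_le_two_pow (n := i)
      simp only [Ready, quota, Nat.add_mul] at *
      omega
    · simp only [Ready, quota, List.length_cons] at *
      rw [Nat.sub_eq_zero_of_le (by omega)]
      simp

/-- The objects of the structure that are still present. -/
def pool (ι : Key) (h : List (Update Obj)) : Finset Obj :=
  survivors (source ι h) (low ι) h

theorem mem_pool {F : Set Obj} {h : List (Update Obj)} (hv : IsValid F h) (ι : Key) {x : Obj} :
    x ∈ pool ι h ↔
      x ∈ objects h ∧ low ι ≤ birth h x ∧ birth h x < insertions (source ι h) :=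
  mem_survivors hv (source_suffix ι h)

theorem pool_subset_objects {F : Set Obj} {h : List (Update Obj)} (hv : IsValid F h) (ι : Key) :
    pool ι h ⊆ objects h := fun _ hx => ((mem_pool hv ι).1 hx).1

theorem mem_pool_inl {F : Set Obj} {h : List (Update Obj)} (hv : IsValid F h) {i j : ℕ}
    (hr : Ready (Sum.inl (i, j)) h) {x : Obj} :
    x ∈ pool (Sum.inl (i, j)) h ↔ x ∈ objects h ∧ birth h x / 2 ^ i = j := by
  rw [mem_pool hv, insertions_source hr, Nat.div_eq_iff (by positivity), low]
  have := Nat.one_le_two_pow (n := i)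
  rw [Nat.add_mul]
  refine and_congr_right fun _ => ⟨fun h => ⟨h.1, by omega⟩, fun h => ⟨h.1, by omega⟩⟩

theorem card_members_inl {F : Set Obj} {h : List (Update Obj)} (hv : IsValid F h) {i j : ℕ}
    (hr : Ready (Sum.inl (i, j)) h) :
    (members (source (Sum.inl (i, j)) h) (low (Sum.inl (i, j)))).card ≤ 2 ^ i := by
  refine (card_members_le (hv.of_suffix (source_suffix _ _)) _).trans ?_
  rw [insertions_source hr, low, Nat.add_mul]
  omega

/-- `wd A l` is a coloring of `A \ l` for weak deletions from the sets `A` of objects of `F`, where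
`l` lists the deleted elements. -/
def IsDeletionScheme {Pt : Type*} (inc : Obj → Pt → Prop) (F : Set Obj) (γ r : ℕ → ℕ)
    (wd : Finset Obj → List Obj → Obj → ℕ) : Prop :=
  ∀ A : Finset Obj, (A : Set Obj) ⊆ F → ∀ l : List Obj, l.Nodup → (∀ x ∈ l, x ∈ A) →
    IsUnimax inc (A \ l.toFinset) (wd A l) ∧
    numColors (A \ l.toFinset) (wd A l) ≤ γ A.card ∧
    ∀ x ∈ A \ l.toFinset,
      numRecolorings (A \ l.toFinset) (A \ (x :: l).toFinset) (wd A l) (wd A (x :: l)) ≤ r A.card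

variable (wd : Finset Obj → List Obj → Obj → ℕ)

/-- The coloring of the structure `ι`. -/
def structColor (ι : Key) (h : List (Update Obj)) : Obj → ℕ :=
  wd (members (source ι h) (low ι))
    (deleted (members (source ι h) (low ι)) (source ι h).length h)

/-- The order in which the objects adopt the colors of the structure `ι`. -/
def rankKey (ι : Key) (h : List (Update Obj)) (x : Obj) : ℕ ×ₗ ℕ :=
  toLex (structColor wd ι h x, birth (source ι h) x)

/-- The objects that have adopted the colors of the structure `ι` or of one of a higher
priority. -/
def active (ι : Key) (h : List (Update Obj)) : Finset Obj :=
  topSet (pool ι h) (rankKey wd ι h) (quota ι h)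

variable {wd}

theorem rankKey_injOn {F : Set Obj} {h : List (Update Obj)} (hv : IsValid F h) (ι : Key) :
    Set.InjOn (rankKey wd ι h) (pool ι h) := by
  intro x hx y hy hxy
  have hsub : pool ι h ⊆ objects (source ι h) :=
    (survivors_subset_members _ _ _).trans (Finset.filter_subset _ _)
  have := congrArg (fun z => (ofLex z).2) hxy
  exact birth_injOn (hv.of_suffix (source_suffix ι h)) (hsub hx) (hsub hy) this

theorem active_subset_pool (ι : Key) (h : List (Update Obj)) : active wd ι h ⊆ pool ι h :=
  topSet_subset _ _ _

theorem active_subset_objects {F : Set Obj} {h : List (Update Obj)} (hv : IsValid F h)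
    (ι : Key) : active wd ι h ⊆ objects h :=
  (active_subset_pool ι h).trans (pool_subset_objects hv ι)

theorem active_eq_empty {ι : Key} {h : List (Update Obj)} (hq : quota ι h = 0) :
    active wd ι h = ∅ := by
  rw [active, hq, topSet_zero]

theorem card_pool_le (ι : Key) (h : List (Update Obj)) :
    (pool ι h).card ≤ (members (source ι h) (low ι)).card :=
  Finset.card_le_card (survivors_subset_members _ _ _)

theorem active_eq_pool {ι : Key} {h : List (Update Obj)}
    (hq : (members (source ι h) (low ι)).card ≤ quota ι h) : active wd ι h = pool ι h :=
  topSet_eq_self _ ((card_pool_le ι h).trans hq)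

/-- The bound on insertions says that the quota has reached `2 ^ i`, the maximal size of the block.
-/
theorem active_inl_eq_pool {F : Set Obj} {h : List (Update Obj)} (hv : IsValid F h) {i j : ℕ}
    (hN : (j + 3) * 2 ^ i ≤ insertions h + 2) :
    active wd (Sum.inl (i, j)) h = pool (Sum.inl (i, j)) h ∧ Ready (Sum.inl (i, j)) h := by
  have := Nat.one_le_two_pow (n := i)
  have hr : Ready (Sum.inl (i, j)) h := by
    simp only [Ready, Nat.add_mul] at *
    omega
  refine ⟨active_eq_pool ((card_members_inl hv hr).trans ?_), hr⟩
  simp only [quota, Nat.add_mul] at *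
  omega

theorem ready_of_mem_active {ι : Key} {h : List (Update Obj)} {x : Obj}
    (hx : x ∈ active wd ι h) : Ready ι h := by
  by_contra hr
  simp [active_eq_empty (quota_eq_zero hr)] at hx

theorem structColor_spec {Pt : Type*} {inc : Obj → Pt → Prop} {F : Set Obj} {γ r : ℕ → ℕ}
    (hwd : IsDeletionScheme inc F γ r wd) {h : List (Update Obj)} (hv : IsValid F h) (ι : Key) :
    IsUnimax inc (active wd ι h) (structColor wd ι h) ∧
      numColors (active wd ι h) (structColor wd ι h) ≤
        γ (members (source ι h) (low ι)).card := by
  have hA : (members (source ι h) (low ι) : Set Obj) ⊆ F :=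
    (Finset.coe_subset.2 (Finset.filter_subset _ _)).trans
      (hv.of_suffix (source_suffix ι h)).objects_subset
  obtain ⟨h1, h2, -⟩ := hwd _ hA _ (deleted_nodup _ (source ι h).length h) mem_of_mem_deleted
  exact ⟨isUnimax_topSet h1 _ _, le_trans
    (Finset.card_le_card (Finset.image_subset_image (active_subset_pool ι h))) h2⟩

variable (wd) in
/-- The structure `ι` is the one of the highest priority whose colors `x` has adopted. -/
def IsKey (h : List (Update Obj)) (x : Obj) (ι : Key) : Prop :=
  x ∈ active wd ι h ∧ ∀ ι', x ∈ active wd ι' h → keyOrd ι' ≤ keyOrd ι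

theorem exists_isKey {F : Set Obj} {h : List (Update Obj)} (hv : IsValid F h) {x : Obj}
    (hx : x ∈ objects h) : ∃ ι, IsKey wd h x ι := by
  classical
  have hb := birth_lt hv hx
  -- The singleton block of `x` is always fully active; the finite set `K` below then guarantees a
  -- maximum.
  have h0 : x ∈ active wd (Sum.inl (0, birth h x)) h := by
    obtain ⟨h1, h2⟩ := active_inl_eq_pool (wd := wd) hv (i := 0) (j := birth h x) (by omega)
    rw [h1, mem_pool_inl hv h2]
    simp [hx]
  let K : Finset Key := (Finset.range (insertions h + 2) ×ˢ Finset.range (insertions h + 2)).disjSum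
    (Finset.range h.length)
  have hK : ∀ ι, x ∈ active wd ι h → ι ∈ K := by
    intro ι hι
    have hq : quota ι h ≠ 0 := fun hq => by simp [active_eq_empty hq] at hι
    rcases ι with ⟨i, j⟩ | T
    · have h1 : i < 2 ^ i := Nat.lt_two_pow_self
      have h2 : j * 1 ≤ j * 2 ^ i := Nat.mul_le_mul_left _ Nat.one_le_two_pow
      simp only [quota, Nat.add_mul] at hq
      simp only [K, Finset.inl_mem_disjSum, Finset.mem_product, Finset.mem_range]
      omega
    · simp only [quota] at hq
      simp only [K, Finset.inr_mem_disjSum, Finset.mem_range]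
      by_contra hT
      rw [Nat.sub_eq_zero_of_le (not_lt.1 hT)] at hq
      simp at hq
  obtain ⟨ι, hι, hmax⟩ := Finset.exists_max_image (K.filter fun ι => x ∈ active wd ι h) keyOrd
    ⟨_, Finset.mem_filter.2 ⟨hK _ h0, h0⟩⟩
  exact ⟨ι, (Finset.mem_filter.1 hι).2,
    fun ι' hι' => hmax ι' (Finset.mem_filter.2 ⟨hK _ hι', hι'⟩)⟩

variable (wd) in
open Classical in
/-- The structure that determines the color of `x`. -/
noncomputable def keyOf (h : List (Update Obj)) (x : Obj) : Key :=
  -- The default concerns no present object of a valid history.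
  if hx : ∃ ι, IsKey wd h x ι then hx.choose else Sum.inr 0

theorem isKey_keyOf {F : Set Obj} {h : List (Update Obj)} (hv : IsValid F h) {x : Obj}
    (hx : x ∈ objects h) : IsKey wd h x (keyOf wd h x) := by
  have := exists_isKey (wd := wd) hv hx
  rw [keyOf, dif_pos this]
  exact this.choose_spec

/-! ### Which structures determine a color -/

section Visible

variable {F : Set Obj} {p h : List (Update Obj)} {x : Obj}

/-- The hypothesis `hc` says that the base created at `p` is fully active, so it hides all blocks
and older bases on the objects born before `p`. -/
theorem mem_active_of_birth_lt (hv : IsValid F h) (hp : p <:+ h) (hs : epochStart p = p)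
    (hc : (objects p).card ≤ 3 * (h.length - p.length)) (hx : x ∈ objects h)
    (hb : birth h x < insertions p) : x ∈ active wd (Sum.inr p.length) h := by
  have hsrc := source_length_suffix hp
  rw [active_eq_pool]
  · rw [mem_pool hv, hsrc]
    exact ⟨hx, Nat.zero_le _, hb⟩
  · rw [hsrc, low, members_zero]
    simp only [source] at hsrc
    simp only [quota, hsrc]
    rwa [if_pos (congrArg List.length hs)]

theorem IsKey.inr_bounds {T : ℕ} (hk : IsKey wd h x (Sum.inr T)) (hv : IsValid F h)
    (hp : p <:+ h) (hs : epochStart p = p)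
    (hc : (objects p).card ≤ 3 * (h.length - p.length)) :
    p.length ≤ T ∧ T < h.length ∧
      epochStart (source (Sum.inr T) h) = source (Sum.inr T) h := by
  have hx := (mem_pool hv _).1 (active_subset_pool _ _ hk.1)
  have hq : quota (Sum.inr T) h ≠ 0 := fun hq => by simpa [active_eq_empty hq] using hk.1
  simp only [quota] at hq
  have hst : epochStart (source (Sum.inr T) h) = source (Sum.inr T) h := by
    by_contra hn
    exact hq (if_neg fun hl => hn ((epochStart_suffix _).eq_of_length hl))
  refine ⟨?_, ?_, hst⟩
  · by_contra hT
    have hle : (source (Sum.inr T) h).length ≤ p.length := by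
      simp only [source, List.length_drop]
      omega
    have hsp : source (Sum.inr T) h <:+ p :=
      List.suffix_of_suffix_length_le (source_suffix _ _) hp hle
    have := mem_active_of_birth_lt (wd := wd) hv hp hs hc hx.1
      (hx.2.2.trans_le (insertions_of_suffix hsp).1)
    exact hT (keyOrd_inr_le_inr.1 (hk.2 _ this))
  · by_contra hT
    rw [Nat.sub_eq_zero_of_le (not_lt.1 hT)] at hq
    simp at hq

/-- The three bounds come from three facts: `x` was born after `p`, since otherwise the base at `p`
would win; the quota of the block is positive; and the parent block `(i + 1, j / 2)` is not yet
fully active. -/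
theorem IsKey.inl_bounds {i j : ℕ} (hk : IsKey wd h x (Sum.inl (i, j))) (hv : IsValid F h)
    (hp : p <:+ h) (hs : epochStart p = p)
    (hc : (objects p).card ≤ 3 * (h.length - p.length)) :
    2 ^ i + insertions p ≤ insertions h ∧ (j + 2) * 2 ^ i ≤ insertions h + 1 ∧
      insertions h + 2 < (j / 2 + 3) * 2 ^ (i + 1) := by
  have hq : quota (Sum.inl (i, j)) h ≠ 0 := fun hq => by simpa [active_eq_empty hq] using hk.1
  have hr := ready_of_mem_active hk.1
  have hpool := active_subset_pool _ _ hk.1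
  have hx := (mem_pool hv _).1 hpool
  have hdiv := ((mem_pool_inl hv hr).1 hpool).2
  have hbirth : insertions p ≤ birth h x := by
    by_contra hb
    exact not_keyOrd_inr_le_inl _ _
      (hk.2 _ (mem_active_of_birth_lt hv hp hs hc hx.1 (not_le.1 hb)))
  rw [insertions_source hr] at hx
  refine ⟨?_, ?_, ?_⟩
  · simp only [quota, Nat.add_mul] at hq hx
    omega
  · simp only [quota] at hq
    omega
  · by_contra hN
    obtain ⟨h1, h2⟩ := active_inl_eq_pool (wd := wd) hv (not_lt.1 hN)
    refine not_keyOrd_succ_le i j (j / 2) (hk.2 _ ?_)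
    rw [h1, mem_pool_inl hv h2]
    exact ⟨hx.1, by rw [pow_succ, ← Nat.div_div_eq_div_mul, hdiv]⟩

end Visible

/-! ### Effect of one update on a single structure -/

variable (wd) in
/-- The remaining objects that start or stop to use the structure `ι`, or whose color in this
structure changes. -/
def changed (ι : Key) (h h' : List (Update Obj)) : Finset Obj :=
  (objects h ∩ objects h').filter fun x =>
    ¬ (x ∈ active wd ι h ↔ x ∈ active wd ι h') ∨
      (x ∈ active wd ι h ∧ structColor wd ι h x ≠ structColor wd ι h' x)

section Changed

variable {F : Set Obj} {ι : Key} {u : Update Obj} {s : Obj} {h : List (Update Obj)}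

theorem card_changed_of_not_ready (hv : IsValid F (u :: h)) (hr : ¬ Ready ι h) :
    (changed wd ι h (u :: h)).card ≤ quota ι (u :: h) - quota ι h := by
  have hq := quota_eq_zero hr
  have hsub : changed wd ι h (u :: h) ⊆ active wd ι (u :: h) := by
    intro x hx
    simpa [changed, active_eq_empty hq] using (Finset.mem_filter.1 hx).2
  have h1 := Finset.card_le_card hsub
  rw [active, card_topSet (rankKey_injOn hv ι)] at h1
  omega

/-- Without a deletion from the structure its ranking is unchanged, so the active set only grows
along it. -/
theorem card_changed_of_deleted_eq (hv : IsValid F (u :: h)) (hr : Ready ι h)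
    (hd : deleted (members (source ι h) (low ι)) (source ι h).length (u :: h) =
      deleted (members (source ι h) (low ι)) (source ι h).length h) :
    (changed wd ι h (u :: h)).card ≤
      min (quota ι (u :: h)) (pool ι h).card - min (quota ι h) (pool ι h).card := by
  have hsrc := source_cons hr u
  have hpool : pool ι (u :: h) = pool ι h := by simp only [pool, survivors, hsrc, hd]
  have hcol : structColor wd ι (u :: h) = structColor wd ι h := by
    simp only [structColor, hsrc, hd]
  have hrank : rankKey wd ι (u :: h) = rankKey wd ι h := by
    funext x
    simp only [rankKey, hcol, hsrc]
  have hact : active wd ι (u :: h) = topSet (pool ι h) (rankKey wd ι h) (quota ι (u :: h)) := by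
    rw [active, hpool, hrank]
  have hsub : active wd ι h ⊆ active wd ι (u :: h) := by
    rw [hact]
    exact topSet_mono _ _ (quota_cons_le ι u h).1
  have hch : changed wd ι h (u :: h) ⊆ active wd ι (u :: h) \ active wd ι h := by
    intro x hx
    have hx := (Finset.mem_filter.1 hx).2
    rw [hcol] at hx
    have := @hsub x
    rw [Finset.mem_sdiff]
    tauto
  refine (Finset.card_le_card hch).trans ?_
  rw [Finset.card_sdiff_of_subset hsub, hact, active,
    card_topSet (rankKey_injOn hv.tail ι), card_topSet (rankKey_injOn hv.tail ι)]

theorem card_changed_ins (hv : IsValid F (Update.ins s :: h)) :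
    (changed wd ι h (Update.ins s :: h)).card ≤ 3 := by
  have hq := quota_cons_le ι (Update.ins s) h
  by_cases hr : Ready ι h
  · have := card_changed_of_deleted_eq (wd := wd) hv hr rfl
    omega
  · have := card_changed_of_not_ready (wd := wd) hv hr
    omega

/-- A change requires a positive quota after the insertion and a quota below `2 ^ i` before it.
These windows are disjoint for the blocks of one level, so only one block is filling. -/
theorem eq_of_mem_changed_ins {i j : ℕ} {x : Obj} (hv : IsValid F (Update.ins s :: h))
    (hx : x ∈ changed wd (Sum.inl (i, j)) h (Update.ins s :: h)) :
    j = (insertions h + 2) / 2 ^ i - 2 := by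
  have hpos := Finset.card_pos.2 ⟨x, hx⟩
  have h1 := Nat.one_le_two_pow (n := i)
  suffices h : (j + 2) * 2 ^ i ≤ insertions h + 2 ∧ insertions h + 2 < (j + 2 + 1) * 2 ^ i by
    have := Nat.div_eq_of_lt_le h.1 h.2
    omega
  have hq : quota (Sum.inl (i, j)) (Update.ins s :: h) = insertions h + 3 - (j + 2) * 2 ^ i := rfl
  have hq' : quota (Sum.inl (i, j)) h = insertions h + 2 - (j + 2) * 2 ^ i := rfl
  by_cases hr : Ready (Sum.inl (i, j)) h
  · have h2 := card_changed_of_deleted_eq (wd := wd) hv hr rfl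
    have h3 := (card_pool_le _ h).trans (card_members_inl hv.tail hr)
    rw [Nat.succ_mul (j + 2)]
    omega
  · have h2 := card_changed_of_not_ready (wd := wd) hv hr
    have h3 := quota_eq_zero hr
    rw [Nat.succ_mul (j + 2)]
    omega

theorem card_changed_del {Pt : Type*} {inc : Obj → Pt → Prop} {γ r : ℕ → ℕ}
    (hwd : IsDeletionScheme inc F γ r wd) (hv : IsValid F (Update.del s :: h)) {ρ : ℕ}
    (hρ : Ready ι h → r (members (source ι h) (low ι)).card ≤ ρ) :
    (changed wd ι h (Update.del s :: h)).card ≤ 3 * ρ + 4 := by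
  have hq := quota_cons_le ι (Update.del s) h
  by_cases hr : Ready ι h
  · by_cases hs : s ∈ pool ι h
    · have hsrc := source_cons hr (Update.del s)
      have hpool : pool ι (Update.del s :: h) = (pool ι h).erase s := by
        rw [pool, hsrc, survivors_del (source_suffix ι h), pool]
      have hinj := rankKey_injOn (wd := wd) hv ι
      have hrec := (hwd (members (source ι h) (low ι))
        ((Finset.coe_subset.2 (Finset.filter_subset _ _)).trans
          (hv.tail.of_suffix (source_suffix ι h)).objects_subset) _
        (deleted_nodup _ (source ι h).length h) mem_of_mem_deleted).2.2 s hs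
      rw [← deleted_del_of_mem (source_suffix ι h) hs] at hrec
      have hX' : members (source ι h) (low ι) \
          (deleted (members (source ι h) (low ι)) (source ι h).length
            (Update.del s :: h)).toFinset = (pool ι h).erase s := by
        rw [← hpool, pool, hsrc, survivors]
      rw [hX'] at hrec
      set D := ((pool ι h).erase s).filter
        fun x => structColor wd ι h x ≠ structColor wd ι (Update.del s :: h) x with hDdef
      have hD : D.card ≤ ρ := by
        refine le_trans (le_of_eq ?_) (hrec.trans (hρ hr))
        rw [numRecolorings]
        congr 1
        ext x
        simp only [hDdef, structColor, hsrc, Finset.mem_filter, Finset.mem_inter]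
        refine and_congr_left fun _ => ⟨fun hx => ⟨Finset.mem_of_mem_erase hx, hx⟩, fun hx => hx.2⟩
      have hkD : ∀ x ∈ (pool ι h).erase s, x ∉ D →
          rankKey wd ι h x = rankKey wd ι (Update.del s :: h) x := by
        intro x hx hxD
        have : structColor wd ι h x = structColor wd ι (Update.del s :: h) x := by
          by_contra hne
          exact hxD (Finset.mem_filter.2 ⟨hx, hne⟩)
        rw [rankKey, rankKey, this, hsrc]
      rw [hpool] at hinj
      have htop := card_topSet_erase_le hs (rankKey_injOn hv.tail ι) hinj D hkD (quota ι h)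
      have hact : active wd ι (Update.del s :: h) = topSet ((pool ι h).erase s)
          (rankKey wd ι (Update.del s :: h)) (quota ι (Update.del s :: h)) := by
        rw [active, hpool]
      set M := topSet (pool ι h) (rankKey wd ι h) (quota ι h) with hM
      set M₀ := topSet ((pool ι h).erase s) (rankKey wd ι (Update.del s :: h)) (quota ι h)
      set M' := topSet ((pool ι h).erase s)
          (rankKey wd ι (Update.del s :: h)) (quota ι (Update.del s :: h))
      have h0 : M₀ ⊆ M' := topSet_mono _ _ hq.1
      have hc : (M' \ M₀).card ≤ 3 := by
        rw [Finset.card_sdiff_of_subset h0, card_topSet hinj, card_topSet hinj]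
        omega
      -- Three sources of change: objects recolored by the weak deletion (`ρ`), reordering and
      -- removal at a fixed quota (`2 * ρ + 1`), and growth of the quota (3).
      have hsub : changed wd ι h (Update.del s :: h) ⊆
          D ∪ ((M.erase s \ M₀) ∪ (M₀ \ M.erase s)) ∪ (M' \ M₀) := by
        intro x hx
        rw [changed, Finset.mem_filter, hact, active, ← hM] at hx
        obtain ⟨hx1, hx2⟩ := hx
        have hxs : x ≠ s := by
          rintro rfl
          simp [objects] at hx1
        have hMX : x ∈ M → x ∈ pool ι h := fun hx => topSet_subset _ _ _ hx
        by_contra hn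
        simp only [Finset.mem_union, Finset.mem_sdiff, Finset.mem_erase, not_or, not_and,
          not_not] at hn
        obtain ⟨⟨hn1, hn2, hn3⟩, hn4⟩ := hn
        rcases hx2 with hx2 | ⟨ha, hb⟩
        · exact hx2 ⟨fun hx => h0 (hn2 ⟨hxs, hx⟩), fun hx => by
            have := hn3 (hn4 hx)
            tauto⟩
        · exact hn1 (Finset.mem_filter.2 ⟨Finset.mem_erase.2 ⟨hxs, hMX ha⟩, hb⟩)
      have e1 := Finset.card_le_card hsub
      have e2 := Finset.card_union_le (D ∪ ((M.erase s \ M₀) ∪ (M₀ \ M.erase s))) (M' \ M₀)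
      have e3 := Finset.card_union_le D ((M.erase s \ M₀) ∪ (M₀ \ M.erase s))
      have e4 := Finset.card_union_le (M.erase s \ M₀) (M₀ \ M.erase s)
      omega
    · have := card_changed_of_deleted_eq (wd := wd) hv hr (deleted_del_of_notMem hs)
      omega
  · have := card_changed_of_not_ready (wd := wd) hv hr
    omega

/-- The quota of a block counts insertions only, so a deletion elsewhere leaves the block alone. -/
theorem mem_pool_of_mem_changed_del {p : ℕ × ℕ} {x : Obj} (hv : IsValid F (Update.del s :: h))
    (hx : x ∈ changed wd (Sum.inl p) h (Update.del s :: h)) :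
    Ready (Sum.inl p) h ∧ s ∈ pool (Sum.inl p) h := by
  have hpos := Finset.card_pos.2 ⟨x, hx⟩
  have hq := quota_inl_del p s h
  by_cases hr : Ready (Sum.inl p) h
  · refine ⟨hr, ?_⟩
    by_contra hs
    have := card_changed_of_deleted_eq (wd := wd) hv hr (deleted_del_of_notMem hs)
    omega
  · have := card_changed_of_not_ready (wd := wd) hv hr
    omega

end Changed

end Structures

end DynamicCF

namespace DynamicCF

/-! ### The maintained coloring and its bounds -/

section Bounds

variable {Obj Pt : Type*} [DecidableEq Obj] {inc : Obj → Pt → Prop} {F : Set Obj} {γ r : ℕ → ℕ}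
  {wd : Finset Obj → List Obj → Obj → ℕ}

variable (wd) in
/-- The maintained coloring. -/
noncomputable def maintained (h : List (Update Obj)) : Obj → ℕ :=
  layeredColor (keyOf wd h) fun ι => structColor wd ι h

theorem isConflictFree_maintained (hwd : IsDeletionScheme inc F γ r wd)
    {h : List (Update Obj)} (hv : IsValid F h) :
    IsConflictFree inc (objects h) (maintained wd h) :=
  isConflictFree_layeredColor keyOrd_injective (M := fun ι => active wd ι h)
    (fun ι => active_subset_objects hv ι) (fun _ hx => (isKey_keyOf hv hx).1)
    (fun _ hx => (isKey_keyOf hv hx).2) (fun ι => (structColor_spec hwd hv ι).1.isConflictFree)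

theorem numRecolorings_maintained_le {h h' : List (Update Obj)} (hv : IsValid F h)
    (hv' : IsValid F h') {W : Finset Key}
    (hW : ∀ x ∈ objects h ∩ objects h', ∀ ι, IsKey wd h x ι ∨ IsKey wd h' x ι →
      x ∈ changed wd ι h h' → ι ∈ W) {B : ℕ} (hB : ∀ ι ∈ W, (changed wd ι h h').card ≤ B) :
    numRecolorings (objects h) (objects h') (maintained wd h) (maintained wd h') ≤
      W.card * B := by
  refine numRecolorings_layeredColor_le keyOrd_injective (M := fun ι => active wd ι h)
    (M' := fun ι => active wd ι h')
    (fun _ hx => (isKey_keyOf hv hx).1) (fun _ hx => (isKey_keyOf hv hx).2)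
    (fun _ hx => (isKey_keyOf hv' hx).1) (fun _ hx => (isKey_keyOf hv' hx).2)
    (Ch := fun ι => changed wd ι h h') (fun x hx ι hc => Finset.mem_filter.2 ⟨hx, hc⟩) ?_ hB
  rintro x hx ι (rfl | rfl) hc
  · exact hW x hx _ (Or.inl (isKey_keyOf hv (Finset.mem_inter.1 hx).1)) hc
  · exact hW x hx _ (Or.inr (isKey_keyOf hv' (Finset.mem_inter.1 hx).2)) hc

/-- The structures that determine colors in the current epoch or immediately after it. -/
theorem IsKey.bounds {h H : List (Update Obj)} (hH : h <:+ H) (hl : H.length ≤ h.length + 1)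
    (hv : IsValid F H) (hn : 1 ≤ (objects H).card) {G : List (Update Obj)} (hG : G = h ∨ G = H)
    {x : Obj} {ι : Key} (hk : IsKey wd G x ι) :
    (∀ T, ι = Sum.inr T → T = (prevEpochStart h).length ∨ T = (epochStart h).length) ∧
      ∀ i j, ι = Sum.inl (i, j) →
        2 ^ i ≤ 3 * (objects H).card ∧ (j + 2) * 2 ^ i ≤ insertions G + 1 ∧
          insertions G + 2 < (j / 2 + 3) * 2 ^ (i + 1) := by
  have hhG : h <:+ G := by rcases hG with rfl | rfl; exacts [List.suffix_rfl, hH]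
  have hGH : G <:+ H := by rcases hG with rfl | rfl; exacts [hH, List.suffix_rfl]
  have heh := epochStart_suffix h
  have hpe := prevEpochStart_suffix h
  have hpG := hpe.trans (heh.trans hhG)
  have hs : epochStart (prevEpochStart h) = prevEpochStart h := epochStart_epochStart _
  have h1 := card_objects_prevEpochStart_le h
  have h2 := heh.length_le
  have h3 := hhG.length_le
  have h4 := hGH.length_le
  have hlt := length_lt_epochStart h
  have hc : (objects (prevEpochStart h)).card ≤
      3 * (G.length - (prevEpochStart h).length) := by omega
  have hvG := hv.of_suffix hGH
  constructor
  · rintro T rfl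
    obtain ⟨hT1, hT2, hT3⟩ := hk.inr_bounds hvG hpG hs hc
    have hlen : (source (Sum.inr T) G).length = T := by
      simp only [source, List.length_drop]
      omega
    have hsuf : source (Sum.inr T) G <:+ h :=
      List.suffix_of_suffix_length_le (source_suffix _ _) hhG (by omega)
    rcases eq_of_epochStart_eq hsuf hT3 (by omega) with h5 | h5
    · left; rw [← h5, hlen]
    · right; rw [← h5, hlen]
  · rintro i j rfl
    obtain ⟨hi1, hi2, hi3⟩ := hk.inl_bounds hvG hpG hs hc
    have h5 := (insertions_of_suffix hpG).2
    have h6 := (epoch_bounds hv (heh.trans hH) (by omega) hn).2.2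
    exact ⟨by omega, hi2, hi3⟩

theorem card_members_base {T : ℕ} {h : List (Update Obj)}
    (hT : T = (prevEpochStart h).length ∨ T = (epochStart h).length) (hv : IsValid F h)
    (hn : 1 ≤ (objects h).card) :
    (members (source (Sum.inr T) h) (low (Sum.inr T))).card ≤ 4 * (objects h).card := by
  have heh := epochStart_suffix h
  have := epoch_bounds hv heh (length_lt_epochStart h).le hn
  rw [low, members_zero]
  rcases hT with rfl | rfl
  · rw [source_length_suffix ((prevEpochStart_suffix h).trans heh)]
    exact this.1
  · rw [source_length_suffix heh]
    exact this.2.1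

theorem numRecolorings_ins_le {s : Obj} {h : List (Update Obj)}
    (hv : IsValid F (Update.ins s :: h)) (hn : 1 ≤ (objects (Update.ins s :: h)).card) :
    numRecolorings (objects h) (objects (Update.ins s :: h)) (maintained wd h)
        (maintained wd (Update.ins s :: h)) ≤
      (Nat.log 2 (objects (Update.ins s :: h)).card + 5) * 3 := by
  classical
  set n := (objects (Update.ins s :: h)).card with hndef
  -- The two visible bases and, per level, the one block that is filling; visible levels satisfy `2
  -- ^ i ≤ 3 * n < 2 ^ (Nat.log 2 n + 3)`.
  let W : Finset Key := {Sum.inr (prevEpochStart h).length, Sum.inr (epochStart h).length} ∪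
    (Finset.range (Nat.log 2 n + 3)).image fun i => Sum.inl (i, (insertions h + 2) / 2 ^ i - 2)
  have hWc : W.card ≤ Nat.log 2 n + 5 := by
    refine (Finset.card_union_le _ _).trans ?_
    have h1 := Finset.card_le_two (a := (Sum.inr (prevEpochStart h).length : Key))
      (b := Sum.inr (epochStart h).length)
    have h2 := Finset.card_image_le (s := Finset.range (Nat.log 2 n + 3))
      (f := fun i => (Sum.inl (i, (insertions h + 2) / 2 ^ i - 2) : Key))
    rw [Finset.card_range] at h2
    omega
  refine (numRecolorings_maintained_le hv.tail hv (W := W) ?_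
    (fun ι _ => card_changed_ins hv)).trans (Nat.mul_le_mul_right 3 hWc)
  intro x hx ι hk hc
  have hb : (∀ T, ι = Sum.inr T → T = (prevEpochStart h).length ∨ T = (epochStart h).length) ∧
      ∀ i j, ι = Sum.inl (i, j) → 2 ^ i ≤ 3 * n := by
    rcases hk with hk | hk
    · have := hk.bounds (List.suffix_cons _ h) le_rfl hv hn (Or.inl rfl)
      exact ⟨this.1, fun i j hi => (this.2 i j hi).1⟩
    · have := hk.bounds (List.suffix_cons _ h) le_rfl hv hn (Or.inr rfl)
      exact ⟨this.1, fun i j hi => (this.2 i j hi).1⟩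
  rcases ι with ⟨i, j⟩ | T
  · refine Finset.mem_union_right _ (Finset.mem_image.2 ⟨i, ?_, ?_⟩)
    · have h1 := hb.2 i j rfl
      have h2 : n < 2 ^ (Nat.log 2 n + 1) := Nat.lt_pow_succ_log_self (by norm_num) n
      have h3 : 2 ^ i < 2 ^ (Nat.log 2 n + 3) := by
        rw [pow_add] at h2 ⊢
        omega
      exact Finset.mem_range.2 ((Nat.pow_lt_pow_iff_right (by norm_num)).1 h3)
    · rw [← eq_of_mem_changed_ins hv hc]
  · refine Finset.mem_union_left _ ?_
    rcases hb.1 T rfl with rfl | rfl <;> simp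

theorem card_filter_two_pow_le (m a : ℕ) :
    ((Finset.range m).filter fun i => 2 ^ i ≤ a ∧ a < 6 * 2 ^ i).card ≤ 3 := by
  have hsub : ((Finset.range m).filter fun i => 2 ^ i ≤ a ∧ a < 6 * 2 ^ i) ⊆
      Finset.Icc (Nat.log 2 a - 2) (Nat.log 2 a) := by
    intro i hi
    obtain ⟨-, h1, h2⟩ := Finset.mem_filter.1 hi
    have h3 := Nat.le_log_of_pow_le (by norm_num) h1
    have h4 : Nat.log 2 a < i + 3 :=
      Nat.log_lt_of_lt_pow (by have := Nat.one_le_two_pow (n := i); omega)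
        (by rw [pow_add]; omega)
    rw [Finset.mem_Icc]
    omega
  refine (Finset.card_le_card hsub).trans ?_
  rw [Nat.card_Icc]
  omega

theorem numRecolorings_del_le (hwd : IsDeletionScheme inc F γ r wd) (hr : Monotone r) {s : Obj}
    {h : List (Update Obj)} (hv : IsValid F (Update.del s :: h))
    (hn : 1 ≤ (objects (Update.del s :: h)).card) :
    numRecolorings (objects h) (objects (Update.del s :: h)) (maintained wd h)
        (maintained wd (Update.del s :: h)) ≤
      5 * (3 * r (8 * (objects (Update.del s :: h)).card) + 4) := by
  classical
  set n := (objects (Update.del s :: h)).card with hndef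
  set t := birth h s
  set N := insertions h
  -- `N - t` is the age of `s`. A positive quota gives the lower bound for a block containing `s`,
  -- and an incomplete parent the upper one; at most three levels satisfy both.
  let I := (Finset.range (3 * n)).filter fun i => 2 ^ i ≤ N - t ∧ N - t < 6 * 2 ^ i
  let W : Finset Key := {Sum.inr (prevEpochStart h).length, Sum.inr (epochStart h).length} ∪
    (I.filter fun i => 2 ^ i ≤ 3 * n).image fun i => Sum.inl (i, t / 2 ^ i)
  have hWc : W.card ≤ 5 := by
    refine (Finset.card_union_le _ _).trans ?_
    have h1 := Finset.card_le_two (a := (Sum.inr (prevEpochStart h).length : Key))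
      (b := Sum.inr (epochStart h).length)
    have h2 := Finset.card_image_le (s := I.filter fun i => 2 ^ i ≤ 3 * n)
      (f := fun i => (Sum.inl (i, t / 2 ^ i) : Key))
    have h3 := Finset.card_filter_le I fun i => 2 ^ i ≤ 3 * n
    have h4 := card_filter_two_pow_le (3 * n) (N - t)
    simp only [I] at *
    omega
  refine (numRecolorings_maintained_le hv.tail hv (W := W) ?_ (fun ι hι =>
    card_changed_del hwd hv (ρ := r (8 * n)) fun hready => hr ?_)).trans
      (Nat.mul_le_mul_right _ hWc)
  · intro x hx ι hk hc
    have hb : (∀ T, ι = Sum.inr T → T = (prevEpochStart h).length ∨ T = (epochStart h).length) ∧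
        ∀ i j, ι = Sum.inl (i, j) → 2 ^ i ≤ 3 * n ∧ (j + 2) * 2 ^ i ≤ N + 1 ∧
          N + 2 < (j / 2 + 3) * 2 ^ (i + 1) := by
      rcases hk with hk | hk
      · exact hk.bounds (List.suffix_cons _ h) le_rfl hv hn (Or.inl rfl)
      · exact hk.bounds (List.suffix_cons _ h) le_rfl hv hn (Or.inr rfl)
    rcases ι with ⟨i, j⟩ | T
    · obtain ⟨h1, h2, h3⟩ := hb.2 i j rfl
      obtain ⟨hready, hs⟩ := mem_pool_of_mem_changed_del hv hc
      have hdiv : t / 2 ^ i = j := ((mem_pool_inl hv.tail hready).1 hs).2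
      have h4 : j * 2 ^ i ≤ t := by rw [← hdiv]; exact Nat.div_mul_le_self _ _
      have h5 : t < (j + 1) * 2 ^ i := by
        rw [← Nat.div_lt_iff_lt_mul (by positivity), hdiv]
        exact Nat.lt_succ_self j
      have h6 : (j / 2) * 2 ^ (i + 1) ≤ j * 2 ^ i := by
        rw [pow_succ', ← mul_assoc]
        exact Nat.mul_le_mul_right _ (Nat.div_mul_le_self j 2)
      have h7 : i < 2 ^ i := Nat.lt_two_pow_self
      refine Finset.mem_union_right _ (Finset.mem_image.2 ⟨i, ?_, by rw [hdiv]⟩)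
      simp only [I, Finset.mem_filter, Finset.mem_range]
      rw [Nat.add_mul, pow_succ'] at *
      refine ⟨⟨by omega, by omega, by omega⟩, h1⟩
    · refine Finset.mem_union_left _ ?_
      rcases hb.1 T rfl with rfl | rfl <;> simp
  · have hl := length_lt_epochStart h
    have heh := epochStart_suffix h
    have heb := epoch_bounds hv (heh.trans (List.suffix_cons _ h))
      (by rw [List.length_cons]; omega) hn
    rcases Finset.mem_union.1 hι with hι | hι
    · rw [Finset.mem_insert, Finset.mem_singleton] at hι
      rcases hι with rfl | rfl
      · rw [source_length_suffix ((prevEpochStart_suffix h).trans heh), low, members_zero]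
        omega
      · rw [source_length_suffix heh, low, members_zero]
        omega
    · obtain ⟨i, hi, rfl⟩ := Finset.mem_image.1 hι
      have h1 := (Finset.mem_filter.1 hi).2
      have h2 := card_members_inl hv.tail hready
      omega

theorem numColors_active_inl_le (hwd : IsDeletionScheme inc F γ r wd) (hγ : Monotone γ)
    {h : List (Update Obj)} (hv : IsValid F h) (i j : ℕ) :
    numColors (active wd (Sum.inl (i, j)) h) (structColor wd (Sum.inl (i, j)) h) ≤
      γ (2 ^ i) := by
  by_cases hr : Ready (Sum.inl (i, j)) h
  · exact (structColor_spec hwd hv _).2.trans (hγ (card_members_inl hv hr))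
  · rw [active_eq_empty (quota_eq_zero hr)]
    simp [numColors]

theorem numColors_maintained_le (hwd : IsDeletionScheme inc F γ r wd) (hγ : Monotone γ)
    {h : List (Update Obj)} (hv : IsValid F h) (hn : 1 ≤ (objects h).card) :
    numColors (objects h) (maintained wd h) ≤
      6 * ∑ i ∈ Finset.range (Nat.log 2 (objects h).card + 3 + 1), γ (2 ^ i) := by
  set n := (objects h).card
  set k := Nat.log 2 n + 3 with hk
  set N := insertions h
  have hlog : 4 * n ≤ 2 ^ k := by
    have : n < 2 ^ (Nat.log 2 n + 1) := Nat.lt_pow_succ_log_self (by norm_num) n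
    rw [hk, pow_add]
    rw [pow_add] at this
    omega
  let V : Finset (Bool ⊕ ℕ × ℕ) :=
    (Finset.univ : Finset Bool).disjSum (Finset.range (k + 1) ×ˢ Finset.range 4)
  -- Visibility of block `(i, j)` gives `j + 2 ≤ (N + 2) / 2 ^ i < j + 6`, hence four candidates per
  -- level.
  let φ : Bool ⊕ ℕ × ℕ → Key := Sum.elim
    (fun b => Sum.inr (if b then (prevEpochStart h).length else (epochStart h).length))
    (fun p => Sum.inl (p.1, (N + 2) / 2 ^ p.1 - 2 - p.2))
  have hV : ∀ x ∈ objects h, ∃ a ∈ V, φ a = keyOf wd h x := by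
    intro x hx
    obtain ⟨h1, h2⟩ := (isKey_keyOf (wd := wd) hv hx).bounds List.suffix_rfl (Nat.le_succ _) hv hn
      (Or.inl rfl)
    generalize keyOf wd h x = ι at *
    rcases ι with ⟨i, j⟩ | T
    · obtain ⟨h3, h4, h5⟩ := h2 i j rfl
      have h6 : (j / 2) * 2 ^ (i + 1) ≤ j * 2 ^ i := by
        rw [pow_succ', ← mul_assoc]
        exact Nat.mul_le_mul_right _ (Nat.div_mul_le_self j 2)
      have h7 : j + 2 ≤ (N + 2) / 2 ^ i :=
        (Nat.le_div_iff_mul_le (by positivity)).2 (by omega)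
      have h8 : (N + 2) / 2 ^ i < j + 6 := by
        rw [Nat.div_lt_iff_lt_mul (by positivity)]
        rw [Nat.add_mul, pow_succ'] at *
        omega
      have h9 : i ≤ k := by
        refine (Nat.pow_le_pow_iff_right (a := 2) (by norm_num)).1 ?_
        omega
      refine ⟨Sum.inr (i, (N + 2) / 2 ^ i - 2 - j), ?_, ?_⟩
      · simp only [V, Finset.inr_mem_disjSum, Finset.mem_product, Finset.mem_range]
        omega
      · simp only [φ, Sum.elim_inr]
        congr 2
        omega
    · rcases h1 T rfl with rfl | rfl
      · exact ⟨Sum.inl true, by simp [V], by simp [φ]⟩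
      · exact ⟨Sum.inl false, by simp [V], by simp [φ]⟩
  refine (numColors_layeredColor_le (M := fun ι => active wd ι h)
    (fun x hx => (isKey_keyOf hv hx).1) hV).trans ?_
  have hbase : ∀ b : Bool, numColors (active wd (φ (Sum.inl b)) h)
      (structColor wd (φ (Sum.inl b)) h) ≤ ∑ i ∈ Finset.range (k + 1), γ (2 ^ i) := by
    intro b
    -- A base has at most `4 * n ≤ 2 ^ k` objects, so the last term of the sum pays for it.
    refine (structColor_spec hwd hv _).2.trans (le_trans (hγ (le_trans
      (card_members_base ?_ hv hn) hlog)) (Finset.single_le_sum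
        (f := fun i => γ (2 ^ i)) (fun _ _ => Nat.zero_le _) (Finset.self_mem_range_succ k)))
    cases b <;> simp
  have hblock : ∑ p ∈ Finset.range (k + 1) ×ˢ Finset.range 4,
      numColors (active wd (φ (Sum.inr p)) h) (structColor wd (φ (Sum.inr p)) h) ≤
        4 * ∑ i ∈ Finset.range (k + 1), γ (2 ^ i) := by
    rw [Finset.sum_product, Finset.mul_sum]
    refine Finset.sum_le_sum fun i _ => ?_
    refine (Finset.sum_le_card_nsmul _ _ (γ (2 ^ i)) fun d _ => ?_).trans (by simp)
    exact numColors_active_inl_le hwd hγ hv _ _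
  have h1 := hbase true
  have h2 := hbase false
  simp only [V, Finset.sum_disjSum, Fintype.sum_bool]
  omega

end Bounds

/-! ### Real logarithms and the absolute constants -/

theorem natLog_mul_le_log {n : ℕ} (hn : n ≠ 0) : (Nat.log 2 n : ℝ) * (2 / 3) ≤ Real.log n := by
  have h1 : ((2 : ℝ) ^ Nat.log 2 n) ≤ n := by exact_mod_cast Nat.pow_log_le_self 2 hn
  have h2 := Real.log_le_log (by positivity) h1
  rw [Real.log_pow] at h2
  have := Real.log_two_gt_d9
  nlinarith [Nat.cast_nonneg (α := ℝ) (Nat.log 2 n)]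

theorem log_le_natLog_add_one (n : ℕ) : Real.log n ≤ Nat.log 2 n + 1 := by
  rcases Nat.eq_zero_or_pos n with rfl | hn
  · simp
  · have h1 : (n : ℝ) ≤ (2 : ℝ) ^ (Nat.log 2 n + 1) := by
      exact_mod_cast (Nat.lt_pow_succ_log_self (b := 2) (by norm_num) n).le
    have h2 := Real.log_le_log (by exact_mod_cast hn) h1
    rw [Real.log_pow] at h2
    have := Real.log_two_lt_d9
    push_cast at h2
    nlinarith [Nat.cast_nonneg (α := ℝ) (Nat.log 2 n)]

theorem two_thirds_le_log {n : ℕ} (hn : 2 ≤ n) : 2 / 3 ≤ Real.log n := by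
  have h1 := Real.log_le_log (by norm_num) (show (2 : ℝ) ≤ n by exact_mod_cast hn)
  have := Real.log_two_gt_d9
  linarith

theorem exists_isDeletionScheme {Obj Pt : Type*} [DecidableEq Obj] {inc : Obj → Pt → Prop}
    {F : Set Obj} {γ r : ℕ → ℕ}
    (hF : ∀ A : Finset Obj, (A : Set Obj) ⊆ F →
      ∃ c : Obj → ℕ, IsUnimax inc A c ∧ numColors A c ≤ γ A.card ∧
        AdmitsWeakDeletions inc A c (γ A.card) (r A.card)) :
    ∃ wd, IsDeletionScheme inc F γ r wd := by
  have : ∀ A : Finset Obj, ∃ col : List Obj → Obj → ℕ, (A : Set Obj) ⊆ F →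
      ∀ l : List Obj, l.Nodup → (∀ x ∈ l, x ∈ A) →
        IsUnimax inc (A \ l.toFinset) (col l) ∧
        numColors (A \ l.toFinset) (col l) ≤ γ A.card ∧
        ∀ x ∈ A \ l.toFinset,
          numRecolorings (A \ l.toFinset) (A \ (x :: l).toFinset) (col l) (col (x :: l)) ≤
            r A.card := by
    intro A
    by_cases hA : (A : Set Obj) ⊆ F
    · obtain ⟨_, -, -, col, -, hcol⟩ := hF A hA
      exact ⟨col, fun _ => hcol⟩
    · exact ⟨fun _ _ => 0, fun h => absurd h hA⟩
  choose wd hwd using this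
  exact ⟨wd, hwd⟩

end DynamicCF

theorem mainTheorem1 :
    ∃ (a C : ℝ) (k : ℕ → ℕ), 0 < a ∧ 0 < C ∧
      -- `k n = Θ(log n)`
      (∀ n : ℕ, 2 ≤ n → a * Real.log n ≤ k n ∧ (k n : ℝ) ≤ C * Real.log n) ∧
      ∀ (Obj : Type*) (Pt : Type*) [DecidableEq Obj] (inc : Obj → Pt → Prop) (F : Set Obj)
        (γ r : ℕ → ℕ), Monotone γ → Monotone r →
        (∀ A : Finset Obj, (A : Set Obj) ⊆ F →
          ∃ c : Obj → ℕ, IsUnimax inc A c ∧ numColors A c ≤ γ A.card ∧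
            AdmitsWeakDeletions inc A c (γ A.card) (r A.card)) →
        -- the maintained coloring depends only on the updates performed so far
        ∃ col : List (Update Obj) → Obj → ℕ,
          ∀ h : List (Update Obj), IsValid F h →
            IsConflictFree inc (objects h) (col h) ∧
            (2 ≤ (objects h).card →
              (numColors (objects h) (col h) : ℝ) ≤
                C * ((∑ i ∈ Finset.range (k (objects h).card + 1), (γ (2 ^ i) : ℝ)) *
                  Real.log (objects h).card)) ∧
            (∀ s : Obj, IsValid F (Update.ins s :: h) →
              (numRecolorings (objects h) (objects (Update.ins s :: h))
                (col h) (col (Update.ins s :: h)) : ℝ) ≤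
                C * Real.log (objects (Update.ins s :: h)).card) ∧
            (∀ s : Obj, IsValid F (Update.del s :: h) →
              (numRecolorings (objects h) (objects (Update.del s :: h))
                (col h) (col (Update.del s :: h)) : ℝ) ≤
                C * ((r (8 * (objects (Update.del s :: h)).card) : ℝ) + 1)) := by
  refine ⟨1, 30, fun n => Nat.log 2 n + 3, one_pos, by norm_num, fun n hn => ?_, ?_⟩
  · have h1 := natLog_mul_le_log (n := n) (by omega)
    have h2 := log_le_natLog_add_one n
    have h3 := two_thirds_le_log hn
    push_cast
    constructor <;> linarith
  · intro Obj Pt _ inc F γ r hγ hr hF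
    obtain ⟨wd, hwd⟩ := exists_isDeletionScheme hF
    refine ⟨maintained wd, fun h hv => ⟨isConflictFree_maintained hwd hv, ?_, ?_, ?_⟩⟩
    · intro hn
      have h1 : (numColors (objects h) (maintained wd h) : ℝ) ≤
          6 * ∑ i ∈ Finset.range (Nat.log 2 (objects h).card + 3 + 1), (γ (2 ^ i) : ℝ) := by
        exact_mod_cast numColors_maintained_le hwd hγ hv (by omega)
      have h2 := two_thirds_le_log hn
      have h3 : 0 ≤ ∑ i ∈ Finset.range (Nat.log 2 (objects h).card + 3 + 1), (γ (2 ^ i) : ℝ) :=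
        Finset.sum_nonneg fun _ _ => Nat.cast_nonneg _
      -- The logarithmic factor is not needed: it is at least `2 / 3`, and `30 * (2 / 3) ≥ 6`.
      nlinarith
    · intro s hv'
      have hcard : (objects (Update.ins s :: h)).card = (objects h).card + 1 :=
        Finset.card_insert_of_notMem hv'.2.2
      -- Insertion into the empty set is separate because the bound is then `log 1 = 0`.
      rcases Nat.eq_zero_or_pos (objects h).card with h0 | h0
      · rw [hcard, Finset.card_eq_zero.1 h0]
        simp [numRecolorings]
      · have h1 : (numRecolorings (objects h) (objects (Update.ins s :: h)) (maintained wd h)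
            (maintained wd (Update.ins s :: h)) : ℝ) ≤
              (Nat.log 2 (objects (Update.ins s :: h)).card + 5) * 3 := by
          exact_mod_cast numRecolorings_ins_le hv' (by omega)
        have h2 := natLog_mul_le_log (n := (objects (Update.ins s :: h)).card) (by omega)
        have h3 := two_thirds_le_log (n := (objects (Update.ins s :: h)).card) (by omega)
        linarith
    · intro s hv'
      rcases Nat.eq_zero_or_pos (objects (Update.del s :: h)).card with h0 | h0
      · rw [Finset.card_eq_zero.1 h0]
        simp only [numRecolorings, Finset.inter_empty, Finset.filter_empty, Finset.card_empty,
          Nat.cast_zero]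
        positivity
      · have h1 : (numRecolorings (objects h) (objects (Update.del s :: h)) (maintained wd h)
            (maintained wd (Update.del s :: h)) : ℝ) ≤
              5 * (3 * r (8 * (objects (Update.del s :: h)).card) + 4) := by
          exact_mod_cast numRecolorings_del_le hwd hr hv' h0
        have h2 : (0 : ℝ) ≤ r (8 * (objects (Update.del s :: h)).card) := Nat.cast_nonneg _
        linarith
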